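/- Let $A_1$ be the complex Weyl algebra, i.e. the unital associative $\mathbb{C}$-algebra generated by $a,a^\dagger$ subject to $[a,a^\dagger]=1$, let $p\mapsto p^\dagger$ be its conjugate-linear anti-automorphism exchanging $a$ and $a^\dagger$, and let $\hat A_1=\{p\in A_1\mid p^\dagger=-p\}$, regarded as a real Lie algebra under the commutator. Put $g_+^{(\alpha,\beta)}=i\big((a^\dagger)^\beta a^\alpha+(a^\dagger)^\alpha a^\beta\big)$ and $g_-^{(\alpha,\beta)}=(a^\dagger)^\beta a^\alpha-(a^\dagger)^\alpha a^\beta$. The elements $g_+^{(\alpha,\beta)}$ with $\alpha\ge\beta\ge 0$ and $g_-^{(\alpha,\beta)}$ with $\alpha>\beta\ge 0$ form a basis of the real vector space $\hat A_1$; equip $\hat A_1$ with the scalar product for which this basis is orthonormal. Let $\hat A_1^\perp$ be the span of all $g_\pm^{(\alpha,\beta)}$ with $\alpha>\beta$ and $\alpha+\beta\ge 3$, and let $\mathcal{P}_{\hat A_1^\perp}$ be the orthogonal projection of $\hat A_1$ onto $\hat A_1^\perp$. Let $\mathcal{G}\subseteq\hat A_1$ be a (finite or infinite) set, $c\in\mathbb{R}$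 and $e\in\hat A_1$. If $\{ia^\dagger a+ic,\,e\}\subseteq\mathcal{G}$ and $\mathcal{P}_{\hat A_1^\perp}(e)\ne 0$, then the real Lie subalgebra $\langle\mathcal{G}\rangle_{\mathrm{Lie}}$ of $\hat A_1$ generated by $\mathcal{G}$ is infinite dimensional. -/

import Mathlib

namespace SkewWeyl

/-! ### The Weyl algebra -/

/-- The two generators: the annihilation operator `a` and the creation operator `a†`. -/
inductive Gen : Type
  | ann : Gen
  | cre : Gen

/-- The canonical commutation relation `a a† - a† a = 1`. -/
inductive CCR : FreeAlgebra ℂ Gen → FreeAlgebra ℂ Gen → Prop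
  | comm : CCR
      (FreeAlgebra.ι ℂ Gen.ann * FreeAlgebra.ι ℂ Gen.cre
        - FreeAlgebra.ι ℂ Gen.cre * FreeAlgebra.ι ℂ Gen.ann) 1

/-- The single-mode complex Weyl algebra: the unital associative `ℂ`-algebra generated by
`a` and `a†` subject to `[a, a†] = 1`. -/
def Weyl : Type := RingQuot CCR

noncomputable section

instance : Ring Weyl := inferInstanceAs (Ring (RingQuot CCR))

instance : Algebra ℂ Weyl := inferInstanceAs (Algebra ℂ (RingQuot CCR))

/-- The quotient map from the free algebra on `a`, `a†` to the Weyl algebra. -/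
def mk : FreeAlgebra ℂ Gen →ₐ[ℂ] Weyl := RingQuot.mkAlgHom ℂ CCR

theorem mk_surjective : Function.Surjective mk := RingQuot.mkAlgHom_surjective ℂ CCR

theorem mk_rel {x y : FreeAlgebra ℂ Gen} (h : CCR x y) : mk x = mk y :=
  RingQuot.mkAlgHom_rel ℂ h

/-- The universal property of the Weyl algebra. -/
def lift {B : Type*} [Ring B] [Algebra ℂ B] (f : FreeAlgebra ℂ Gen →ₐ[ℂ] B)
    (hf : ∀ ⦃x y⦄, CCR x y → f x = f y) : Weyl →ₐ[ℂ] B :=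
  RingQuot.liftAlgHom ℂ ⟨f, hf⟩

theorem lift_mk {B : Type*} [Ring B] [Algebra ℂ B] (f : FreeAlgebra ℂ Gen →ₐ[ℂ] B)
    (hf : ∀ ⦃x y⦄, CCR x y → f x = f y) (x : FreeAlgebra ℂ Gen) : lift f hf (mk x) = f x :=
  RingQuot.liftAlgHom_mkAlgHom_apply ℂ f hf x

/-- The annihilation operator `a`. -/
def ann : Weyl := mk (FreeAlgebra.ι ℂ Gen.ann)

/-- The creation operator `a†`. -/
def cre : Weyl := mk (FreeAlgebra.ι ℂ Gen.cre)

theorem ann_mul_cre : ann * cre = cre * ann + 1 := by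
  have h := mk_rel CCR.comm
  simp only [map_sub, map_mul, map_one] at h
  exact sub_eq_iff_eq_add'.mp h

/-- An element of the Weyl algebra is obtained from scalars, `a` and `a†` by sums and products. -/
theorem weyl_induction {P : Weyl → Prop} (hs : ∀ z : ℂ, P (algebraMap ℂ Weyl z))
    (ha : P ann) (hc : P cre) (hadd : ∀ x y, P x → P y → P (x + y))
    (hmul : ∀ x y, P x → P y → P (x * y)) (x : Weyl) : P x := by
  obtain ⟨y, rfl⟩ := mk_surjective x
  induction y using FreeAlgebra.induction with
  | grade0 r => rw [AlgHom.commutes]; exact hs r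
  | grade1 g => cases g; exacts [ha, hc]
  | mul u v hu hv => rw [map_mul]; exact hmul _ _ hu hv
  | add u v hu hv => rw [map_add]; exact hadd _ _ hu hv

/-- The normally ordered monomial `a^(α,β) = (a†)^α a^β`. -/
def normalMonomial (γ : ℕ × ℕ) : Weyl := cre ^ γ.1 * ann ^ γ.2

/-! ### The dagger operation -/

/-- The opposite algebra of the Weyl algebra with the complex conjugate scalar action. -/
def ConjOp : Type := Weylᵐᵒᵖ

instance : Ring ConjOp := inferInstanceAs (Ring Weylᵐᵒᵖ)

instance : Algebra ℂ ConjOp :=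
  RingHom.toAlgebra' ((algebraMap ℂ Weylᵐᵒᵖ).comp (starRingEnd ℂ))
    (fun z x => Algebra.commutes (A := Weylᵐᵒᵖ) ((starRingEnd ℂ) z) x)

def ConjOp.of (x : Weyl) : ConjOp := MulOpposite.op x

def ConjOp.val (x : ConjOp) : Weyl := MulOpposite.unop x

theorem ConjOp.val_add (x y : ConjOp) : (x + y).val = x.val + y.val := rfl
theorem ConjOp.val_sub (x y : ConjOp) : (x - y).val = x.val - y.val := rfl
theorem ConjOp.val_mul (x y : ConjOp) : (x * y).val = y.val * x.val := rfl
theorem ConjOp.val_one : (1 : ConjOp).val = 1 := rfl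
theorem ConjOp.val_of (x : Weyl) : (ConjOp.of x).val = x := rfl
theorem ConjOp.val_injective : Function.Injective ConjOp.val := MulOpposite.unop_injective
theorem ConjOp.val_algebraMap (z : ℂ) :
    (algebraMap ℂ ConjOp z).val = algebraMap ℂ Weyl ((starRingEnd ℂ) z) := rfl

/-- The dagger operation, as a homomorphism to the opposite conjugate algebra; it is determined
by `a ↦ a†` and `a† ↦ a`. -/
def daggerHom : Weyl →ₐ[ℂ] ConjOp :=
  lift
    (FreeAlgebra.lift ℂ (fun g => match g with
      | Gen.ann => ConjOp.of cre
      | Gen.cre => ConjOp.of ann)) (by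
      rintro _ _ ⟨⟩
      apply ConjOp.val_injective
      simp only [map_sub, map_mul, map_one, FreeAlgebra.lift_ι_apply, ConjOp.val_sub,
        ConjOp.val_mul, ConjOp.val_one, ConjOp.val_of]
      rw [ann_mul_cre]; abel)

/-- The dagger operation `p ↦ p†`: the conjugate-linear anti-automorphism of the Weyl algebra
that exchanges `a` and `a†`. -/
def dagger (x : Weyl) : Weyl := (daggerHom x).val

theorem dagger_add (x y : Weyl) : dagger (x + y) = dagger x + dagger y := by
  simp only [dagger, map_add, ConjOp.val_add]

theorem dagger_mul (x y : Weyl) : dagger (x * y) = dagger y * dagger x := by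
  simp only [dagger, map_mul, ConjOp.val_mul]

theorem dagger_algebraMap (z : ℂ) :
    dagger (algebraMap ℂ Weyl z) = algebraMap ℂ Weyl ((starRingEnd ℂ) z) := by
  rw [dagger, AlgHom.commutes, ConjOp.val_algebraMap]

theorem dagger_ann : dagger ann = cre := by
  simp only [dagger, daggerHom, ann, lift_mk,
    FreeAlgebra.lift_ι_apply, ConjOp.val_of]

theorem dagger_cre : dagger cre = ann := by
  simp only [dagger, daggerHom, cre, lift_mk,
    FreeAlgebra.lift_ι_apply, ConjOp.val_of]

theorem dagger_dagger (x : Weyl) : dagger (dagger x) = x := by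
  induction x using weyl_induction with
  | hs z => simp [dagger_algebraMap]
  | ha => rw [dagger_ann, dagger_cre]
  | hc => rw [dagger_cre, dagger_ann]
  | hadd x y hx hy => rw [dagger_add, dagger_add, hx, hy]
  | hmul x y hx hy => rw [dagger_mul, dagger_mul, hx, hy]

instance : StarRing Weyl where
  star := dagger
  star_involutive := dagger_dagger
  star_mul := dagger_mul
  star_add := dagger_add

theorem star_ann : star ann = cre := dagger_ann
theorem star_cre : star cre = ann := dagger_cre

instance : StarModule ℂ Weyl where
  star_smul z x := by
    rw [Algebra.smul_def, star_mul, Algebra.smul_def, Algebra.commutes]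
    congr 1
    exact dagger_algebraMap z

theorem star_normalMonomial (γ : ℕ × ℕ) :
    star (normalMonomial γ) = normalMonomial γ.swap := by
  simp [normalMonomial, star_mul, star_pow, star_ann, star_cre]

/-! ### The canonical basis of normally ordered monomials -/

theorem ann_mul_cre_pow (k : ℕ) :
    ann * cre ^ k = cre ^ k * ann + (k : ℂ) • cre ^ (k - 1) := by
  induction k with
  | zero => simp
  | succ k ih =>
    have h1 : (k : ℂ) • (cre ^ (k - 1) * cre) = (k : ℂ) • cre ^ k := by
      rcases k with _ | k
      · simp
      · rw [Nat.add_sub_cancel, ← pow_succ]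
    rw [pow_succ, ← mul_assoc, ih, add_mul, mul_assoc, ann_mul_cre, mul_add, smul_mul_assoc, h1,
      Nat.add_sub_cancel, mul_one, Nat.cast_add, Nat.cast_one, add_smul, one_smul, mul_assoc,
      add_assoc, add_comm (cre ^ k)]

theorem mul_mem_span_normalMonomial (x : Weyl) :
    ∀ y ∈ Submodule.span ℂ (Set.range normalMonomial),
      x * y ∈ Submodule.span ℂ (Set.range normalMonomial) := by
  induction x using weyl_induction with
  | hs z => intro y hy; rw [← Algebra.smul_def]; exact Submodule.smul_mem _ _ hy
  | hadd u v hu hv => intro y hy; rw [add_mul]; exact Submodule.add_mem _ (hu y hy) (hv y hy)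
  | hmul u v hu hv => intro y hy; rw [mul_assoc]; exact hu _ (hv y hy)
  | ha =>
    intro y hy
    induction hy using Submodule.span_induction with
    | zero => simp
    | add u v _ _ hu hv => rw [mul_add]; exact Submodule.add_mem _ hu hv
    | smul z u _ hu => rw [mul_smul_comm]; exact Submodule.smul_mem _ _ hu
    | mem u hu =>
      obtain ⟨⟨α, β⟩, rfl⟩ := hu
      rw [normalMonomial, ← mul_assoc, ann_mul_cre_pow, add_mul, mul_assoc, ← pow_succ',
        smul_mul_assoc]
      exact Submodule.add_mem _ (Submodule.subset_span ⟨(α, β + 1), rfl⟩)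
        (Submodule.smul_mem _ _ (Submodule.subset_span ⟨(α - 1, β), rfl⟩))
  | hc =>
    intro y hy
    induction hy using Submodule.span_induction with
    | zero => simp
    | add u v _ _ hu hv => rw [mul_add]; exact Submodule.add_mem _ hu hv
    | smul z u _ hu => rw [mul_smul_comm]; exact Submodule.smul_mem _ _ hu
    | mem u hu =>
      obtain ⟨⟨α, β⟩, rfl⟩ := hu
      rw [normalMonomial, ← mul_assoc, ← pow_succ']
      exact Submodule.subset_span ⟨(α + 1, β), rfl⟩

theorem span_normalMonomial : Submodule.span ℂ (Set.range normalMonomial) = ⊤ := by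
  rw [eq_top_iff]
  rintro x -
  have h := mul_mem_span_normalMonomial x 1 (Submodule.subset_span ⟨(0, 0), by simp [normalMonomial]⟩)
  rwa [mul_one] at h

/-- The Bargmann representation on `ℂ[X]`: `a` acts as `d/dX`, and `a†` as multiplication by
`X`. It is used only to show that the normally ordered monomials are linearly independent. -/
def bargmann : Weyl →ₐ[ℂ] Module.End ℂ (Polynomial ℂ) :=
  lift
    (FreeAlgebra.lift ℂ (fun g => match g with
      | Gen.ann => Polynomial.derivative
      | Gen.cre => LinearMap.mulLeft ℂ Polynomial.X)) (by
      rintro _ _ ⟨⟩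
      refine LinearMap.ext fun p => ?_
      simp [FreeAlgebra.lift_ι_apply])

theorem bargmann_ann : bargmann ann = Polynomial.derivative := by
  simp only [bargmann, ann, lift_mk, FreeAlgebra.lift_ι_apply]

theorem bargmann_cre : bargmann cre = LinearMap.mulLeft ℂ Polynomial.X := by
  simp only [bargmann, cre, lift_mk, FreeAlgebra.lift_ι_apply]

theorem bargmann_normalMonomial (γ : ℕ × ℕ) (n : ℕ) :
    bargmann (normalMonomial γ) (Polynomial.X ^ n) =
      Polynomial.C (n.descFactorial γ.2 : ℂ) * Polynomial.X ^ (γ.1 + (n - γ.2)) := by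
  rw [normalMonomial, map_mul bargmann, map_pow bargmann, map_pow bargmann, bargmann_ann,
    bargmann_cre, LinearMap.pow_mulLeft, Module.End.mul_apply, Module.End.pow_apply,
    Polynomial.iterate_derivative_X_pow_eq_C_mul, LinearMap.mulLeft_apply, pow_add]
  ring

theorem linearIndependent_normalMonomial : LinearIndependent ℂ normalMonomial := by
  rw [linearIndependent_iff]
  intro l hl
  have key : ∀ β α : ℕ, l (α, β) = 0 := by
    intro β
    induction β using Nat.strong_induction_on with
    | _ β ih =>
      intro α
      have h := congrArg (fun x => (bargmann x (Polynomial.X ^ β)).coeff α) hl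
      simp only [Finsupp.linearCombination_apply, Finsupp.sum, map_sum, map_smul,
        LinearMap.sum_apply, LinearMap.smul_apply, bargmann_normalMonomial,
        Polynomial.finsetSum_coeff, Polynomial.coeff_smul, Polynomial.coeff_C_mul,
        Polynomial.coeff_X_pow, map_zero, LinearMap.zero_apply, Polynomial.coeff_zero,
        smul_eq_mul] at h
      rw [Finset.sum_eq_single (α, β)] at h
      · simpa [Nat.descFactorial_self, Nat.factorial_ne_zero] using h
      · rintro ⟨α', β'⟩ - hne
        rcases lt_trichotomy β' β with hlt | heq | hgt
        · rw [ih β' hlt α', zero_mul]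
        · subst heq
          have : α ≠ α' := fun h => hne (by rw [h])
          simp [this]
        · simp [Nat.descFactorial_of_lt hgt]
      · intro hns
        rw [Finsupp.notMem_support_iff.mp hns, zero_mul]
  ext ⟨α, β⟩
  exact key β α

/-- The canonical basis of the Weyl algebra, formed by the normally ordered monomials. -/
def canonicalBasis : Module.Basis (ℕ × ℕ) ℂ Weyl :=
  Module.Basis.mk linearIndependent_normalMonomial span_normalMonomial.ge

theorem canonicalBasis_apply (γ : ℕ × ℕ) : canonicalBasis γ = normalMonomial γ := by
  simp [canonicalBasis]

theorem canonicalBasis_repr (γ : ℕ × ℕ) :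
    canonicalBasis.repr (normalMonomial γ) = Finsupp.single γ 1 := by
  rw [← canonicalBasis_apply, Module.Basis.repr_self]

/-! ### The skew-hermitian Weyl algebra and its monomials -/

/-- The Lie bracket of the Weyl algebra is the commutator `[x, y] = x y - y x`. -/
instance : LieRing Weyl := LieRing.ofAssociativeRing

instance : LieAlgebra ℝ Weyl := LieAlgebra.ofAssociativeAlgebra

theorem lie_eq (x y : Weyl) : ⁅x, y⁆ = x * y - y * x := rfl

theorem real_smul_eq (r : ℝ) (x : Weyl) : r • x = (r : ℂ) • x := rfl

theorem star_real_smul (r : ℝ) (x : Weyl) : star (r • x) = r • star x := by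
  rw [real_smul_eq, real_smul_eq, star_smul, RCLike.star_def, Complex.conj_ofReal]

/-- The skew-hermitian Weyl algebra `Â₁ = {p | p† = -p}`, a real Lie algebra under the
commutator. -/
def skewWeyl : LieSubalgebra ℝ Weyl where
  carrier := {p | star p = -p}
  zero_mem' := by simp
  add_mem' {x y} hx hy := by
    simp only [Set.mem_ofPred_eq] at hx hy ⊢
    rw [star_add, hx, hy, neg_add]
  smul_mem' r x hx := by
    simp only [Set.mem_ofPred_eq] at hx ⊢
    rw [star_real_smul, hx, smul_neg]
  lie_mem' {x y} hx hy := by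
    have hx' : star x = -x := hx
    have hy' : star y = -y := hy
    change star ⁅x, y⁆ = -⁅x, y⁆
    rw [lie_eq, star_sub, star_mul, star_mul, hx', hy', neg_mul_neg, neg_mul_neg,
      neg_sub]

theorem mem_skewWeyl {p : Weyl} : p ∈ skewWeyl ↔ star p = -p := Iff.rfl

/-- `g₊^γ = i ((a^γ)† + a^γ)`. -/
def gPlus (γ : ℕ × ℕ) : skewWeyl :=
  ⟨Complex.I • (star (normalMonomial γ) + normalMonomial γ), by
    rw [mem_skewWeyl, star_smul, star_add, star_star, RCLike.star_def, Complex.conj_I, neg_smul,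
      add_comm]⟩

/-- `g₋^γ = (a^γ)† - a^γ`. -/
def gMinus (γ : ℕ × ℕ) : skewWeyl :=
  ⟨star (normalMonomial γ) - normalMonomial γ, by
    rw [mem_skewWeyl, star_sub, star_star, neg_sub]⟩

/-- Labels of the monomials of `Â₁`: `g₊^(α,β)` with `α ≥ β`, and `g₋^(α,β)` with `α > β`. -/
inductive MonomialIndex : Type
  | plus (α β : ℕ) (h : β ≤ α) : MonomialIndex
  | minus (α β : ℕ) (h : β < α) : MonomialIndex

/-- The monomials `g_σ^γ` of `Â₁`. -/
def monomial : MonomialIndex → skewWeyl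
  | .plus α β _ => gPlus (α, β)
  | .minus α β _ => gMinus (α, β)

/-- The coordinate functional of `p ∈ Â₁` with respect to the canonical monomial `a^γ`. -/
def coordAt (γ : ℕ × ℕ) : skewWeyl →ₗ[ℝ] ℂ :=
  (canonicalBasis.coord γ).restrictScalars ℝ ∘ₗ skewWeyl.toSubmodule.subtype

theorem coordAt_gPlus (γ δ : ℕ × ℕ) :
    coordAt γ (gPlus δ) = Complex.I * ((if δ.swap = γ then 1 else 0) + if δ = γ then 1 else 0) := by
  change canonicalBasis.repr (Complex.I • (star (normalMonomial δ) + normalMonomial δ)) γ = _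
  simp only [star_normalMonomial, map_smul, map_add, canonicalBasis_repr, Finsupp.smul_apply,
    Finsupp.add_apply, Finsupp.single_apply, smul_eq_mul]

theorem coordAt_gMinus (γ δ : ℕ × ℕ) :
    coordAt γ (gMinus δ) = (if δ.swap = γ then 1 else 0) - if δ = γ then 1 else 0 := by
  change canonicalBasis.repr (star (normalMonomial δ) - normalMonomial δ) γ = _
  simp only [star_normalMonomial, map_sub, canonicalBasis_repr, Finsupp.sub_apply,
    Finsupp.single_apply]

/-- The coefficient of `g_σ^γ`, read off from the canonical basis. -/
def monomialCoeff : MonomialIndex → Module.Dual ℝ skewWeyl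
  | .plus α β _ => (if α = β then (1 / 2 : ℝ) else 1) • (Complex.imLm ∘ₗ coordAt (α, β))
  | .minus α β _ => -(Complex.reLm ∘ₗ coordAt (α, β))

theorem linearIndependent_monomial : LinearIndependent ℝ monomial := by
  refine LinearIndependent.of_pairwise_dual_eq_zero_one monomial monomialCoeff ?_ ?_
  · rintro (⟨α, β, h⟩ | ⟨α, β, h⟩) (⟨α', β', h'⟩ | ⟨α', β', h'⟩) hne <;>
      simp only [monomial, monomialCoeff, LinearMap.smul_apply, LinearMap.neg_apply,
        LinearMap.comp_apply, coordAt_gPlus, coordAt_gMinus, Prod.swap_prod_mk, Prod.mk.injEq,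
        smul_eq_mul, Complex.imLm_coe, Complex.reLm_coe]
    · have h1 : ¬(α' = α ∧ β' = β) := by rintro ⟨rfl, rfl⟩; exact hne rfl
      have h2 : ¬(β' = α ∧ α' = β) := by omega
      simp [h1, h2]
    · split_ifs <;> simp
    · split_ifs <;> simp
    · have h1 : ¬(α' = α ∧ β' = β) := by rintro ⟨rfl, rfl⟩; exact hne rfl
      have h2 : ¬(β' = α ∧ α' = β) := by omega
      simp [h1, h2]
  · rintro (⟨α, β, h⟩ | ⟨α, β, h⟩) <;>
      simp only [monomial, monomialCoeff, LinearMap.smul_apply, LinearMap.neg_apply,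
        LinearMap.comp_apply, coordAt_gPlus, coordAt_gMinus, Prod.swap_prod_mk, Prod.mk.injEq,
        smul_eq_mul, Complex.imLm_coe, Complex.reLm_coe]
    · by_cases hab : α = β
      · subst hab; norm_num
      · simp [hab]
    · have h2 : ¬(β = α ∧ α = β) := by omega
      simp [h2]

/-- The skew-hermitian part `p ↦ (p - p†)/2`, as a map to `Â₁`. -/
def skewPart : Weyl →ₗ[ℝ] skewWeyl where
  toFun p := ⟨(1 / 2 : ℝ) • (p - star p), by
    rw [mem_skewWeyl, star_real_smul, star_sub, star_star, ← smul_neg, neg_sub]⟩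
  map_add' x y := by
    apply Subtype.ext
    change (1 / 2 : ℝ) • (x + y - star (x + y)) =
      (1 / 2 : ℝ) • (x - star x) + (1 / 2 : ℝ) • (y - star y)
    rw [star_add]; module
  map_smul' r x := by
    apply Subtype.ext
    change (1 / 2 : ℝ) • (r • x - star (r • x)) = r • (1 / 2 : ℝ) • (x - star x)
    rw [star_real_smul]; module

theorem gPlus_mem_span (γ : ℕ × ℕ) : gPlus γ ∈ Submodule.span ℝ (Set.range monomial) := by
  obtain ⟨α, β⟩ := γ
  rcases le_total β α with h | h
  · exact Submodule.subset_span ⟨.plus α β h, rfl⟩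
  · have : gPlus (α, β) = gPlus (β, α) := by
      apply Subtype.ext
      simp only [gPlus, star_normalMonomial, Prod.swap_prod_mk]
      rw [add_comm]
    rw [this]
    exact Submodule.subset_span ⟨.plus β α h, rfl⟩

theorem gMinus_mem_span (γ : ℕ × ℕ) : gMinus γ ∈ Submodule.span ℝ (Set.range monomial) := by
  obtain ⟨α, β⟩ := γ
  rcases lt_trichotomy β α with h | h | h
  · exact Submodule.subset_span ⟨.minus α β h, rfl⟩
  · subst h
    have : gMinus (β, β) = 0 := by
      apply Subtype.ext
      simp [gMinus, star_normalMonomial]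
    rw [this]
    exact Submodule.zero_mem _
  · have : gMinus (α, β) = -gMinus (β, α) := by
      apply Subtype.ext
      simp [gMinus, star_normalMonomial]
    rw [this]
    exact Submodule.neg_mem _ (Submodule.subset_span ⟨.minus β α h, rfl⟩)

theorem skewPart_smul_normalMonomial (z : ℂ) (γ : ℕ × ℕ) :
    skewPart (z • normalMonomial γ) = (z.im / 2) • gPlus γ - (z.re / 2) • gMinus γ := by
  apply Subtype.ext
  obtain ⟨x, y⟩ := z
  have hz : (⟨x, y⟩ : ℂ) = (x : ℂ) + (y : ℂ) * Complex.I := Complex.mk_eq_add_mul_I x y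
  change ((1 / 2 : ℝ) : ℂ) • ((⟨x, y⟩ : ℂ) • normalMonomial γ
      - star ((⟨x, y⟩ : ℂ) • normalMonomial γ)) =
    ((y / 2 : ℝ) : ℂ) • Complex.I • (star (normalMonomial γ) + normalMonomial γ)
      - ((x / 2 : ℝ) : ℂ) • (star (normalMonomial γ) - normalMonomial γ)
  rw [star_smul, hz]
  simp only [RCLike.star_def, map_add, map_mul, Complex.conj_I, Complex.conj_ofReal]
  push_cast
  module

theorem skewPart_mem_span (p : Weyl) : skewPart p ∈ Submodule.span ℝ (Set.range monomial) := by
  suffices h : ∀ z : ℂ, skewPart (z • p) ∈ Submodule.span ℝ (Set.range monomial) by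
    simpa using h 1
  have hp : p ∈ Submodule.span ℂ (Set.range normalMonomial) :=
    span_normalMonomial ▸ Submodule.mem_top
  induction hp using Submodule.span_induction with
  | zero => simp
  | add u v _ _ hu hv =>
    intro z; rw [smul_add, map_add]; exact Submodule.add_mem _ (hu z) (hv z)
  | smul w u _ hu => intro z; rw [smul_smul]; exact hu _
  | mem u hu =>
    obtain ⟨γ, rfl⟩ := hu
    intro z
    rw [skewPart_smul_normalMonomial]
    exact Submodule.sub_mem _ (Submodule.smul_mem _ _ (gPlus_mem_span γ))
      (Submodule.smul_mem _ _ (gMinus_mem_span γ))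

theorem skewPart_coe (p : skewWeyl) : skewPart p = p := by
  apply Subtype.ext
  have h : star (p : Weyl) = -p := p.2
  simp only [skewPart, LinearMap.coe_mk, AddHom.coe_mk, h]
  module

theorem span_monomial : Submodule.span ℝ (Set.range monomial) = ⊤ := by
  rw [eq_top_iff]
  rintro p -
  rw [← skewPart_coe p]
  exact skewPart_mem_span p

/-- The basis of `Â₁` formed by the monomials `g_σ^γ`. -/
def monomialBasis : Module.Basis MonomialIndex ℝ skewWeyl :=
  Module.Basis.mk linearIndependent_monomial span_monomial.ge

theorem monomialBasis_apply (k : MonomialIndex) : monomialBasis k = monomial k := by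
  simp [monomialBasis]

/-! ### Scalar product, orthogonal projections, and the space `Â₁^⊥` -/

/-- The scalar product on `Â₁` for which the monomials `g_σ^γ` form an orthonormal basis. -/
def scalarProduct (v w : skewWeyl) : ℝ :=
  (monomialBasis.repr v).sum fun k r => r * monomialBasis.repr w k

open Classical in
theorem scalarProduct_monomial (j k : MonomialIndex) :
    scalarProduct (monomial j) (monomial k) = if j = k then 1 else 0 := by
  rw [← monomialBasis_apply, ← monomialBasis_apply, scalarProduct]
  simp [Finsupp.single_apply, eq_comm]

theorem scalarProduct_monomial_right (v : skewWeyl) (k : MonomialIndex) :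
    scalarProduct v (monomial k) = monomialBasis.repr v k := by
  classical
  rw [← monomialBasis_apply, scalarProduct]
  simp only [Module.Basis.repr_self, Finsupp.single_apply, mul_ite, mul_one, mul_zero]
  rw [Finsupp.sum_ite_eq, Finsupp.if_mem_support]

/-- The orthogonal projection `v ↦ ∑_{b ∈ B} ⟨v|b⟩ b` onto the subspace with orthonormal basis
`B`. For a set `B` of monomials only finitely many terms are nonzero. -/
def proj (B : Set skewWeyl) (v : skewWeyl) : skewWeyl :=
  ∑ᶠ b ∈ B, scalarProduct v b • b

/-- The basis `{g_σ^(α,β) | α > β, α + β ≥ 3}` of the space `Â₁^⊥`. -/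
def perpMonomials : Set skewWeyl :=
  {x | ∃ α β : ℕ, β < α ∧ 3 ≤ α + β ∧ (x = gPlus (α, β) ∨ x = gMinus (α, β))}

/-- The space `Â₁^⊥`. -/
def perpSpace : Submodule ℝ skewWeyl := Submodule.span ℝ perpMonomials

/-- The orthogonal projection of `Â₁` onto `Â₁^⊥`. -/
def projPerp (v : skewWeyl) : skewWeyl := proj perpMonomials v

theorem projPerp_mem (v : skewWeyl) : projPerp v ∈ perpSpace :=
  finsum_mem_induction (· ∈ perpSpace) (Submodule.zero_mem _)
    (fun _ _ hx hy => Submodule.add_mem _ hx hy)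
    (fun _ hb => Submodule.smul_mem _ _ (Submodule.subset_span hb))

theorem perpMonomials_subset : perpMonomials ⊆ Set.range monomial := by
  rintro _ ⟨α, β, h, -, rfl | rfl⟩
  exacts [⟨.plus α β h.le, rfl⟩, ⟨.minus α β h, rfl⟩]

/-- For a set `B` of monomials, the sum defining the projection is finite. -/
theorem proj_support_finite {B : Set skewWeyl} (hB : B ⊆ Set.range monomial) (v : skewWeyl) :
    (B ∩ Function.support fun b => scalarProduct v b • b).Finite := by
  refine ((monomialBasis.repr v).support.finite_toSet.image monomial).subset ?_
  rintro b ⟨hb, hs⟩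
  obtain ⟨k, rfl⟩ := hB hb
  refine ⟨k, ?_, rfl⟩
  rw [Function.mem_support, scalarProduct_monomial_right] at hs
  exact Finsupp.mem_support_iff.mpr fun h => hs (by rw [h, zero_smul])

/-! ### The free Hamiltonian -/

/-- The element `i a†a + i c` of `Â₁`, for a real number `c`. -/
def freeHamiltonian (c : ℝ) : skewWeyl :=
  ⟨Complex.I • (cre * ann) + algebraMap ℂ Weyl (Complex.I * c), by
    rw [mem_skewWeyl, star_add, star_smul, star_mul, star_ann, star_cre, Algebra.algebraMap_eq_smul_one,
      star_smul, star_one]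
    simp only [RCLike.star_def, map_mul, Complex.conj_I, Complex.conj_ofReal, neg_mul, neg_smul]
    abel⟩

end

end SkewWeyl

open Polynomial

/-! Write `N = a†a`. Weight vectors of `ad N` are not skew-hermitian for nonzero weight, so the
argument passes to the complex span `M` of the Lie algebra. `M` is closed under commutators and `†`
and stable under `ad N`, since the scalar `ic` is central. A polynomial in `ad N` therefore extracts
from `e` a component of weight `k = α - β ≥ 1` (`exists_cre_pow_mul_aeval_mem`), where `a^(α,β)`
occurs in `e` and `α + β ≥ 3`. It has the form `x = (a†)^k f(N)` with `deg f ≥ β`, so `k + 2 deg f ≥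
3`.

The commutator `[x†, x]` is `g(N)`, where `g` is the step-`k` difference of a polynomial of degree
`2 deg f + k ≥ 3` (`exists_star_lie_self`). Commuting `g(N)` with `(a†)^k h(N)` multiplies `h` by
the difference `q` of `g`. Two differences cost at most two degrees, so `q` is nonconstant and the
elements `(a†)^k (q^n f)(N)` of `M` are linearly independent
(`not_finite_of_cre_pow_mul_aeval_mem`). A finite-dimensional real Lie algebra would have a
finite-dimensional complex span. -/

theorem SemiconjBy.aeval {R A : Type*} [CommSemiring R] [Semiring A] [Algebra R A] {a x y : A}
    (h : SemiconjBy a x y) (p : R[X]) :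
    SemiconjBy a (Polynomial.aeval x p) (Polynomial.aeval y p) := by
  induction p using Polynomial.induction_on' with
  | add p q hp hq => rw [map_add, map_add]; exact hp.add_right hq
  | monomial n r =>
    rw [aeval_monomial, aeval_monomial]
    exact SemiconjBy.mul_right (Algebra.commutes r a).symm (h.pow_right n)

/-- If `p` has degree `n + 1`, the coefficient of `X^n` in `p(X + r) - p(X)` is `(n + 1) r` times
the leading coefficient of `p`, nonzero in characteristic zero. -/
theorem Polynomial.natDegree_le_natDegree_comp_X_add_C_sub {K : Type*} [Field K] [CharZero K]
    {r : K} (hr : r ≠ 0) (p : K[X]) :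
    p.natDegree ≤ (p.comp (X + C r) - p).natDegree + 1 := by
  rcases hn : p.natDegree with _ | n
  · omega
  · rw [Nat.add_le_add_iff_right]
    apply le_natDegree_of_ne_zero
    -- The `n`-th Taylor coefficient at `r` is the value of this Hasse derivative, a polynomial with
    -- only two coefficients.
    have hd : (hasseDeriv n p).natDegree < 2 :=
      (natDegree_hasseDeriv_le p n).trans_lt (by omega)
    rw [coeff_sub, ← taylor_apply, taylor_coeff, eval_eq_sum_range' hd]
    have hp : p.coeff (n + 1) ≠ 0 := by
      rw [← hn]; exact fun h => by
        have := leadingCoeff_eq_zero.mp h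
        simp [this] at hn
    simp only [Finset.sum_range_succ, Finset.sum_range_zero, hasseDeriv_coeff]
    have : ((n : K) + 1) ≠ 0 := by exact_mod_cast n.succ_ne_zero
    simpa [add_comm 1 n, this, hr] using hp

namespace SkewWeyl

/-! ### Polynomials in the number operator -/

/-- The number operator `a†a`. -/
noncomputable def number : Weyl := cre * ann

theorem star_number : star number = number := by
  rw [number, star_mul, star_ann, star_cre]

theorem semiconjBy_cre_pow (k : ℕ) :
    SemiconjBy (cre ^ k) (number + algebraMap ℂ Weyl k) number := by
  rw [SemiconjBy, number, mul_assoc cre, ann_mul_cre_pow, mul_add, mul_add, ← mul_assoc,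
    ← mul_assoc, ← pow_succ, ← pow_succ', mul_smul_comm, ← Algebra.commutes, ← Algebra.smul_def]
  -- The exponent `k - 1` truncates at `k = 0`, where its coefficient vanishes.
  rcases k with _ | k
  · simp
  · rw [Nat.add_sub_cancel, ← pow_succ']

theorem star_aeval_number (p : ℂ[X]) :
    star (aeval number p) = aeval number (p.map (starRingEnd ℂ)) := by
  induction p using Polynomial.induction_on' with
  | add p q hp hq => simp only [map_add, star_add, hp, hq, Polynomial.map_add]
  | monomial n r =>
    rw [aeval_monomial, map_monomial, aeval_monomial, star_mul, star_pow, star_number,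
      Algebra.commutes]
    congr 1
    exact dagger_algebraMap r

theorem aeval_number_mul_cre_pow (p : ℂ[X]) (k : ℕ) :
    aeval number p * cre ^ k = cre ^ k * aeval number (p.comp (X + C (k : ℂ))) := by
  have := (semiconjBy_cre_pow k).aeval p
  rw [aeval_comp]
  simpa using this.eq.symm

/-- Peeling off the innermost pair leaves `(a†)^k N a^k`, and `N` turns into `N - k` when moved left
past `(a†)^k`. The product is `N(N-1)⋯(N-k+1)`. -/
theorem cre_pow_mul_ann_pow (k : ℕ) :
    cre ^ k * ann ^ k = aeval number (descPochhammer ℂ k) := by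
  induction k with
  | zero => simp
  | succ k ih =>
    have h : number * cre ^ k = cre ^ k * (number + algebraMap ℂ Weyl k) :=
      (semiconjBy_cre_pow k).eq.symm
    rw [descPochhammer_succ_right, pow_succ, pow_succ', mul_comm, map_mul, ← ih]
    have : cre ^ k * number = (number - algebraMap ℂ Weyl k) * cre ^ k := by
      rw [sub_mul, h, mul_add, Algebra.commutes]; abel
    rw [mul_assoc, ← mul_assoc cre, ← mul_assoc (cre ^ k)]
    change cre ^ k * number * _ = _
    rw [this]
    simp [mul_assoc]

/-- Here the innermost pair is `aa† = N + 1`, which becomes `N + k + 1` when moved right past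
`(a†)^k`. The product is `(N+1)⋯(N+k)`. -/
theorem ann_pow_mul_cre_pow (k : ℕ) :
    ann ^ k * cre ^ k = aeval number ((descPochhammer ℂ k).comp (X + C (k : ℂ))) := by
  induction k with
  | zero => simp
  | succ k ih =>
    have h : (ann * cre) * cre ^ k = cre ^ k * aeval number (X + C ((k + 1 : ℕ) : ℂ)) := by
      have := (semiconjBy_cre_pow k).eq
      rw [ann_mul_cre, add_mul]
      change number * _ + _ = _
      rw [← this, one_mul, ← mul_add_one]
      simp [add_assoc]
    have hd : (descPochhammer ℂ (k + 1)).comp (X + C ((k + 1 : ℕ) : ℂ)) =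
        (descPochhammer ℂ k).comp (X + C (k : ℂ)) * (X + C ((k + 1 : ℕ) : ℂ)) := by
      rw [descPochhammer_succ_left, mul_comp, X_comp, comp_assoc, mul_comm]
      congr 2
      simp
      ring
    rw [hd, map_mul, ← ih, mul_assoc, ← h, pow_succ ann, pow_succ' cre]
    simp only [mul_assoc]

theorem normalMonomial_add (k β : ℕ) :
    normalMonomial (k + β, β) = cre ^ k * aeval number (descPochhammer ℂ β) := by
  rw [normalMonomial, ← cre_pow_mul_ann_pow, ← mul_assoc, pow_add]

theorem bargmann_number_X_pow (n : ℕ) :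
    bargmann number (X ^ n) = (n : ℂ) • X ^ n := by
  have := bargmann_normalMonomial (1, 1) n
  rw [normalMonomial, pow_one, pow_one] at this
  rw [number, this]
  rcases n with _ | n
  · simp
  · simp [smul_eq_C_mul, add_comm]

theorem bargmann_cre_pow_mul_aeval (k n : ℕ) (p : ℂ[X]) :
    bargmann (cre ^ k * aeval number p) (X ^ n) = p.eval (n : ℂ) • X ^ (k + n) := by
  have h : bargmann (aeval number p) (X ^ n) = p.eval (n : ℂ) • X ^ n := by
    rw [← aeval_algHom_apply]
    exact Module.End.aeval_apply_of_hasEigenvector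
      ⟨Module.End.mem_eigenspace_iff.mpr (bargmann_number_X_pow n), by simp⟩
  rw [map_mul, Module.End.mul_apply, h, map_smul, map_pow bargmann, bargmann_cre, LinearMap.pow_mulLeft,
    LinearMap.mulLeft_apply, pow_add]

/-- In the Bargmann representation `X^n` is an eigenvector of `N` with eigenvalue `n`, so the
operator determines the values of the polynomial at all natural numbers. -/
theorem cre_pow_mul_aeval_injective (k : ℕ) :
    Function.Injective fun p : ℂ[X] => cre ^ k * aeval number p := by
  intro p q h
  refine Polynomial.eq_of_infinite_eval_eq p q
    ((Set.infinite_range_of_injective (Nat.cast_injective (R := ℂ))).mono ?_)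
  rintro _ ⟨n, rfl⟩
  have h' := congrArg (fun x => (bargmann x (X ^ n)).coeff (k + n)) h
  simp only [bargmann_cre_pow_mul_aeval] at h'
  simpa using h'

/-! ### Commutators of weight vectors and infinite dimension -/

theorem aeval_number_sub_lie (g f : ℂ[X]) (k : ℕ) :
    aeval number g * (cre ^ k * aeval number f) - cre ^ k * aeval number f * aeval number g =
      cre ^ k * aeval number ((g.comp (X + C (k : ℂ)) - g) * f) := by
  rw [← mul_assoc, aeval_number_mul_cre_pow, sub_mul, map_sub, mul_sub, mul_comm g f]
  simp only [map_mul, mul_assoc]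

/-- The commutator of `x†` and `x`, for `x = (a†)^k f(a†a)`, is the `k`-th difference of a
polynomial in `a†a`. -/
theorem exists_star_lie_self (f : ℂ[X]) (hf : f ≠ 0) (k : ℕ) :
    ∃ p : ℂ[X], p.natDegree = 2 * f.natDegree + k ∧
      star (cre ^ k * aeval number f) * (cre ^ k * aeval number f) -
        cre ^ k * aeval number f * star (cre ^ k * aeval number f) =
      aeval number (p.comp (X + C (k : ℂ)) - p) := by
  set F := f.map (starRingEnd ℂ) with hF
  have hF0 : F ≠ 0 := (Polynomial.map_ne_zero_iff (RingHom.injective _)).mpr hf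
  -- The shift by `-k` is what `f(N) F(N)` acquires when moved left past `(a†)^k`. Thus `xx†` is `w
  -- · descPochhammer` at `N`, and `x†x` is the same polynomial at `N + k`.
  set w := (f * F).comp (X - C (k : ℂ)) with hw
  have hw' : w.comp (X + C (k : ℂ)) = f * F := by
    rw [hw, comp_assoc]; simp
  have hd : w.natDegree = 2 * f.natDegree := by
    rw [hw, natDegree_comp, natDegree_X_sub_C, mul_one, natDegree_mul hf hF0, hF, natDegree_map,
      two_mul]
  have hw0 : w ≠ 0 := by
    intro h
    rw [h, zero_comp] at hw'
    exact mul_ne_zero hf hF0 hw'.symm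
  refine ⟨w * descPochhammer ℂ k, ?_, ?_⟩
  · rw [natDegree_mul hw0 (monic_descPochhammer ℂ k).ne_zero, hd, descPochhammer_natDegree]
  · have hs : star (cre ^ k * aeval number f) = aeval number F * ann ^ k := by
      rw [star_mul, star_aeval_number, star_pow, star_cre]
    have h1 : aeval number F * ann ^ k * (cre ^ k * aeval number f) =
        aeval number ((w * descPochhammer ℂ k).comp (X + C (k : ℂ))) := by
      rw [mul_assoc, ← mul_assoc (ann ^ k), ann_pow_mul_cre_pow, mul_comp, hw', ← map_mul,
        ← map_mul]
      congr 1
      ring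
    have h2 : cre ^ k * aeval number f * (aeval number F * ann ^ k) =
        aeval number (w * descPochhammer ℂ k) := by
      rw [mul_assoc, ← mul_assoc (aeval number f), ← map_mul, ← hw', ← mul_assoc,
        ← aeval_number_mul_cre_pow, mul_assoc, cre_pow_mul_ann_pow, map_mul]
    rw [hs, h1, h2, map_sub]

/-- A space of Weyl algebra elements closed under commutators and `†` which contains
`(a†)^k f(a†a)` with `f ≠ 0`, `k ≥ 1` and `k + 2 deg f ≥ 3` is infinite dimensional. -/
theorem not_finite_of_cre_pow_mul_aeval_mem (M : Submodule ℂ Weyl)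
    (hlie : ∀ x ∈ M, ∀ y ∈ M, x * y - y * x ∈ M) (hstar : ∀ x ∈ M, star x ∈ M)
    {k : ℕ} (hk : k ≠ 0) {f : ℂ[X]} (hf : f ≠ 0) (hdeg : 3 ≤ k + 2 * f.natDegree)
    (hx : cre ^ k * aeval number f ∈ M) : ¬ Module.Finite ℂ M := by
  intro hfin
  obtain ⟨p, hp, hpx⟩ := exists_star_lie_self f hf k
  set g := p.comp (X + C (k : ℂ)) - p
  set q := g.comp (X + C (k : ℂ)) - g with hq
  have hg : aeval number g ∈ M := hpx ▸ hlie _ (hstar _ hx) _ hx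
  have hk' : (k : ℂ) ≠ 0 := Nat.cast_ne_zero.mpr hk
  -- Each difference lowers the degree by at most one, starting from `2 deg f + k ≥ 3`.
  have hqd : 1 ≤ q.natDegree := by
    have h1 : p.natDegree ≤ g.natDegree + 1 := natDegree_le_natDegree_comp_X_add_C_sub hk' p
    have h2 : g.natDegree ≤ q.natDegree + 1 := natDegree_le_natDegree_comp_X_add_C_sub hk' g
    omega
  have hpow : ∀ n, cre ^ k * aeval number (q ^ n * f) ∈ M := by
    intro n
    induction n with
    | zero => simpa using hx
    | succ n ih =>
      rw [pow_succ', mul_assoc, hq, ← aeval_number_sub_lie]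
      exact hlie _ hg _ ih
  -- `T r = (a†)^k (r(q) f)(N)`. It embeds `ℂ[X]` into `M`, because a nonconstant `q` is
  -- transcendental over `ℂ`.
  let T : ℂ[X] →ₗ[ℂ] Weyl := LinearMap.mulLeft ℂ (cre ^ k) ∘ₗ (aeval number).toLinearMap ∘ₗ
    LinearMap.mulRight ℂ f ∘ₗ (aeval q).toLinearMap
  have hT : ∀ r, T r ∈ M := by
    intro r
    induction r using Polynomial.induction_on' with
    | add r s hr hs => rw [map_add]; exact M.add_mem hr hs
    | monomial n z =>
      rw [← mul_one z, ← smul_eq_mul, ← smul_monomial, map_smul]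
      refine M.smul_mem _ ?_
      simpa [T, aeval_monomial] using hpow n
  have hinj : Function.Injective T := by
    intro r s h
    have h1 := mul_right_cancel₀ hf (cre_pow_mul_aeval_injective k h)
    have ht : Transcendental ℂ q := q.transcendental (by omega)
      (mem_nonZeroDivisors_of_ne_zero (leadingCoeff_ne_zero.mpr (ne_zero_of_natDegree_gt hqd)))
    exact (transcendental_iff_injective.mp ht) h1
  exact Polynomial.not_finite (R := ℂ)
    (Module.Finite.of_injective (T.codRestrict M hT) fun r s h => hinj (congrArg Subtype.val h))

/-! ### Weight decomposition under the number operator -/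

theorem number_lie_normalMonomial (γ : ℕ × ℕ) :
    number * normalMonomial γ - normalMonomial γ * number =
      ((γ.1 : ℂ) - γ.2) • normalMonomial γ := by
  obtain ⟨α, β⟩ := γ
  have h1 := (semiconjBy_cre_pow α).eq
  -- The dagger of the relation for `(a†)^β` is the one for `a^β`.
  have h2 := congrArg star (semiconjBy_cre_pow β).eq
  simp only [star_mul, star_pow, star_cre, star_add, star_number] at h2
  have h3 : star (algebraMap ℂ Weyl β) = algebraMap ℂ Weyl β := by
    rw [show star (algebraMap ℂ Weyl β) = _ from dagger_algebraMap β]; simp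
  rw [h3] at h2
  have hc' := Algebra.commutes (α : ℂ) (cre ^ α)
  simp only [normalMonomial]
  rw [mul_assoc (cre ^ α), ← h2, ← mul_assoc, ← h1, Algebra.smul_def, map_sub]
  simp only [mul_add, add_mul, sub_mul, ← mul_assoc, hc', Algebra.commutes (β : ℂ) (cre ^ α)]
  abel

/-- The commutator with `a†a`. -/
noncomputable def adNumber : Module.End ℂ Weyl :=
  LinearMap.mulLeft ℂ number - LinearMap.mulRight ℂ number

theorem aeval_adNumber_normalMonomial (p : ℂ[X]) (γ : ℕ × ℕ) :
    aeval adNumber p (normalMonomial γ) = p.eval ((γ.1 : ℂ) - γ.2) • normalMonomial γ :=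
  Module.End.aeval_apply_of_hasEigenvector
    ⟨Module.End.mem_eigenspace_iff.mpr (number_lie_normalMonomial γ),
      linearIndependent_normalMonomial.ne_zero γ⟩

theorem aeval_apply_mem_of_forall_mem {K V : Type*} [Field K] [AddCommGroup V] [Module K V]
    {M : Submodule K V} {D : Module.End K V} (hD : ∀ x ∈ M, D x ∈ M) (p : K[X]) {x : V}
    (hx : x ∈ M) : aeval D p x ∈ M := by
  induction p using Polynomial.induction_on' with
  | add p q hp hq => rw [map_add]; exact M.add_mem hp hq
  | monomial n r =>
    rw [aeval_monomial, ← Algebra.smul_def, LinearMap.smul_apply]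
    refine M.smul_mem _ ?_
    induction n with
    | zero => simpa
    | succ n ih => rw [pow_succ', Module.End.mul_apply]; exact hD _ ih

/-- A space of Weyl algebra elements invariant under the commutator with `a†a` contains the weight
components of its elements. -/
theorem exists_cre_pow_mul_aeval_mem {M : Submodule ℂ Weyl}
    (hM : ∀ x ∈ M, adNumber x ∈ M) {x : Weyl} (hx : x ∈ M) {k β : ℕ}
    (hcoord : canonicalBasis.repr x (k + β, β) ≠ 0) :
    ∃ f : ℂ[X], f ≠ 0 ∧ β ≤ f.natDegree ∧ cre ^ k * aeval number f ∈ M := by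
  classical
  set l := canonicalBasis.repr x with hl
  let wt : ℕ × ℕ → ℂ := fun γ => (γ.1 : ℂ) - γ.2
  -- This interpolation polynomial is `1` at `k` and `0` at the other weights occurring in `x`, so
  -- `p(ad N)` sends `x` to its component of weight `k`.
  let p : ℂ[X] := Lagrange.basis (l.support.image wt) id (k : ℂ)
  have hwt : wt (k + β, β) = k := by simp [wt]
  have hmem : (k + β, β) ∈ l.support := Finsupp.mem_support_iff.mpr hcoord
  have hkmem : (k : ℂ) ∈ l.support.image wt :=
    Finset.mem_image.mpr ⟨_, hmem, hwt⟩
  have hp : ∀ γ ∈ l.support, p.eval (wt γ) = if wt γ = k then 1 else 0 := by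
    intro γ hγ
    split_ifs with h
    · rw [h]; exact Lagrange.eval_basis_self (v := id) Function.injective_id.injOn hkmem
    · exact Lagrange.eval_basis_of_ne (v := id) (Ne.symm h) (Finset.mem_image_of_mem wt hγ)
  have hsum : x = ∑ γ ∈ l.support, l γ • normalMonomial γ := by
    rw [← canonicalBasis.linearCombination_repr x, Finsupp.linearCombination_apply, Finsupp.sum]
    simp only [canonicalBasis_apply, hl]
  let s := l.support.filter fun γ => wt γ = k
  have hs : ∀ γ ∈ s, γ.1 = k + γ.2 := by
    intro γ hγ
    have := (Finset.mem_filter.mp hγ).2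
    simp only [wt, sub_eq_iff_eq_add] at this
    exact_mod_cast this
  let c : ℕ × ℕ → ℂ[X] := fun γ => l γ • descPochhammer ℂ γ.2
  have hc : ∀ γ ∈ s, (c γ).degree = γ.2 := by
    intro γ hγ
    have hne : l γ ≠ 0 := Finsupp.mem_support_iff.mp (Finset.mem_filter.mp hγ).1
    rw [degree_smul_of_smul_regular _ (IsSMulRegular.of_ne_zero hne),
      degree_eq_natDegree (monic_descPochhammer ℂ γ.2).ne_zero, descPochhammer_natDegree]
  have hks : (k + β, β) ∈ s := Finset.mem_filter.mpr ⟨hmem, hwt⟩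
  -- At fixed weight the second index determines the monomial and is the degree of its polynomial.
  -- The degrees are thus distinct and no leading terms cancel.
  have hdeg : (β : WithBot ℕ) ≤ (∑ γ ∈ s, c γ).degree := by
    rw [degree_sum_eq_of_disjoint]
    · exact (hc _ hks).ge.trans (Finset.le_sup (f := fun γ => (c γ).degree) hks)
    · rintro γ ⟨hγ, -⟩ δ ⟨hδ, -⟩ hne h
      simp only [Function.comp, hc γ hγ, hc δ hδ, Nat.cast_inj] at h
      exact hne (Prod.ext (by rw [hs γ hγ, hs δ hδ, h]) h)
  have hne : ∑ γ ∈ s, c γ ≠ 0 := ne_zero_of_coe_le_degree hdeg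
  refine ⟨∑ γ ∈ s, c γ, hne, le_natDegree_of_coe_le_degree hdeg, ?_⟩
  have key : aeval adNumber p x = cre ^ k * aeval number (∑ γ ∈ s, c γ) := by
    conv_lhs => rw [hsum]
    rw [map_sum, map_sum, Finset.mul_sum, Finset.sum_filter]
    refine Finset.sum_congr rfl fun γ hγ => ?_
    rw [map_smul, aeval_adNumber_normalMonomial]
    change l γ • p.eval (wt γ) • _ = _
    rw [hp γ hγ]
    split_ifs with h
    · obtain ⟨α, β'⟩ := γ
      have := hs _ (Finset.mem_filter.mpr ⟨hγ, h⟩)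
      simp only at this
      rw [this, one_smul, normalMonomial_add, ← this]
      simp only [c, map_smul, mul_smul_comm]
    · simp
  rw [← key]
  exact aeval_apply_mem_of_forall_mem hM p hx

/-! ### From the projection to a canonical coordinate -/

theorem monomialBasis_coord (k : MonomialIndex) : monomialBasis.coord k = monomialCoeff k := by
  refine monomialBasis.ext fun j => ?_
  rw [Module.Basis.coord_apply, Module.Basis.repr_self, monomialBasis_apply]
  rcases k with ⟨α, β, h⟩ | ⟨α, β, h⟩ <;> rcases j with ⟨α', β', h'⟩ | ⟨α', β', h'⟩ <;>
    simp only [monomial, monomialCoeff, LinearMap.smul_apply, LinearMap.neg_apply,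
      LinearMap.comp_apply, coordAt_gPlus, coordAt_gMinus, Prod.swap_prod_mk, Prod.mk.injEq,
      smul_eq_mul, Complex.imLm_coe, Complex.reLm_coe]
  · by_cases hj : α' = α ∧ β' = β
    · obtain ⟨rfl, rfl⟩ := hj
      by_cases hab : α' = β'
      · subst hab; norm_num
      · simp [hab]
    · have h2 : ¬(β' = α ∧ α' = β) := by omega
      simp [hj, h2]
  · split_ifs <;> simp
  · split_ifs <;> simp
  · have h2 : ¬(β' = α ∧ α' = β) := by omega
    by_cases hj : α' = α ∧ β' = β
    · obtain ⟨rfl, rfl⟩ := hj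
      simp [h2]
    · simp [hj, h2]

/-- For `α > β` the coefficients of `g₊` and `g₋` are the imaginary part and minus the real part of
the coordinate at `(α, β)`, so both vanish with it. -/
theorem exists_coordAt_ne_zero {e : skewWeyl} (h : projPerp e ≠ 0) :
    ∃ α β : ℕ, β < α ∧ 3 ≤ α + β ∧ coordAt (α, β) e ≠ 0 := by
  contrapose! h
  refine finsum_mem_eq_zero_of_forall_eq_zero fun b hb => ?_
  obtain ⟨α, β, hlt, h3, hb⟩ := hb
  have h0 := h α β hlt h3
  suffices scalarProduct e b = 0 by rw [this, zero_smul]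
  rcases hb with rfl | rfl
  · rw [show gPlus (α, β) = monomial (.plus α β hlt.le) from rfl, scalarProduct_monomial_right,
      ← Module.Basis.coord_apply, monomialBasis_coord]
    simp [monomialCoeff, hlt.ne', h0]
  · rw [show gMinus (α, β) = monomial (.minus α β hlt) from rfl, scalarProduct_monomial_right,
      ← Module.Basis.coord_apply, monomialBasis_coord]
    simp [monomialCoeff, h0]

/-! ### Complexification of the Lie subalgebra -/

/-- The complex span of a real Lie subalgebra of `Â₁` inside the Weyl algebra. -/
noncomputable def complexSpan (L : LieSubalgebra ℝ skewWeyl) : Submodule ℂ Weyl :=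
  Submodule.span ℂ (((↑) : skewWeyl → Weyl) '' (L : Set skewWeyl))

theorem mem_complexSpan {L : LieSubalgebra ℝ skewWeyl} {x : skewWeyl} (hx : x ∈ L) :
    (x : Weyl) ∈ complexSpan L := Submodule.subset_span ⟨x, hx, rfl⟩

theorem lie_mem_complexSpan {L : LieSubalgebra ℝ skewWeyl} :
    ∀ x ∈ complexSpan L, ∀ y ∈ complexSpan L, x * y - y * x ∈ complexSpan L := by
  intro x hx y hy
  induction hx, hy using Submodule.span_induction₂ with
  | mem_mem x y hx hy =>
    obtain ⟨x, hx, rfl⟩ := hx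
    obtain ⟨y, hy, rfl⟩ := hy
    exact mem_complexSpan (L.lie_mem hx hy)
  | zero_left y hy => simp
  | zero_right x hx => simp
  | add_left x y z _ _ _ h1 h2 =>
    convert Submodule.add_mem _ h1 h2 using 1
    noncomm_ring
  | add_right x y z _ _ _ h1 h2 =>
    convert Submodule.add_mem _ h1 h2 using 1
    noncomm_ring
  | smul_left r x y _ _ h =>
    rw [smul_mul_assoc, mul_smul_comm, ← smul_sub]; exact Submodule.smul_mem _ _ h
  | smul_right r x y _ _ h =>
    rw [smul_mul_assoc, mul_smul_comm, ← smul_sub]; exact Submodule.smul_mem _ _ h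

/-- On generators `†` is negation, and it is conjugate-linear. -/
theorem star_mem_complexSpan {L : LieSubalgebra ℝ skewWeyl} :
    ∀ x ∈ complexSpan L, star x ∈ complexSpan L := by
  intro x hx
  induction hx using Submodule.span_induction with
  | mem x hx =>
    obtain ⟨x, hx, rfl⟩ := hx
    rw [mem_skewWeyl.mp x.2]
    exact Submodule.neg_mem _ (mem_complexSpan hx)
  | zero => simp
  | add x y _ _ hx hy => rw [star_add]; exact Submodule.add_mem _ hx hy
  | smul r x _ hx => rw [star_smul]; exact Submodule.smul_mem _ _ hx

theorem finite_complexSpan (L : LieSubalgebra ℝ skewWeyl) [Module.Finite ℝ L] :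
    Module.Finite ℂ (complexSpan L) := by
  have h : L.toSubmodule.FG := Module.Finite.iff_fg.mp ‹_›
  obtain ⟨t, ht⟩ := h.map skewWeyl.toSubmodule.subtype
  refine Module.Finite.iff_fg.mpr ⟨t, ?_⟩
  rw [← Submodule.span_span_of_tower ℝ ℂ (t : Set Weyl), ht]
  rfl

/-- The scalar `ic` is central, and multiplying by `-i`, available only over `ℂ`, turns `ad (iN)`
into `ad N`. -/
theorem adNumber_mem_complexSpan {L : LieSubalgebra ℝ skewWeyl} {c : ℝ}
    (hc : freeHamiltonian c ∈ L) : ∀ x ∈ complexSpan L, adNumber x ∈ complexSpan L := by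
  intro x hx
  have h := Submodule.smul_mem _ (-Complex.I) (lie_mem_complexSpan _ (mem_complexSpan hc) x hx)
  convert h using 1
  have hcomm := Algebra.commutes (Complex.I * c) x
  change number * x - x * number =
    -Complex.I • ((Complex.I • number + algebraMap ℂ Weyl (Complex.I * c)) * x
      - x * (Complex.I • number + algebraMap ℂ Weyl (Complex.I * c)))
  rw [add_mul, mul_add, hcomm, add_sub_add_right_eq_sub, smul_mul_assoc, mul_smul_comm,
    ← smul_sub, smul_smul]
  simp

end SkewWeyl

theorem mainTheorem10 (G : Set SkewWeyl.skewWeyl) (c : ℝ) (e : SkewWeyl.skewWeyl)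
    (hc : SkewWeyl.freeHamiltonian c ∈ G) (he : e ∈ G) (hperp : SkewWeyl.projPerp e ≠ 0) :
    ¬ FiniteDimensional ℝ (LieSubalgebra.lieSpan ℝ SkewWeyl.skewWeyl G) := by
  intro hfin
  obtain ⟨α, β, hlt, h3, h0⟩ := SkewWeyl.exists_coordAt_ne_zero hperp
  obtain ⟨k, rfl⟩ := Nat.exists_eq_add_of_lt hlt
  -- The weight is `k + 1`, so `α + β = (k + 1) + 2β`, and `β ≤ deg f` yields the required degree
  -- bound.
  rw [show β + k + 1 = (k + 1) + β by omega] at h0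
  have hG := LieSubalgebra.subset_lieSpan (R := ℝ) (L := SkewWeyl.skewWeyl) (s := G)
  obtain ⟨f, hf, hd, hx⟩ := SkewWeyl.exists_cre_pow_mul_aeval_mem
    (SkewWeyl.adNumber_mem_complexSpan (hG hc)) (SkewWeyl.mem_complexSpan (hG he)) h0
  exact SkewWeyl.not_finite_of_cre_pow_mul_aeval_mem _ SkewWeyl.lie_mem_complexSpan
    SkewWeyl.star_mem_complexSpan k.succ_ne_zero hf (by omega) hx
    (SkewWeyl.finite_complexSpan _)
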